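/- Let $\Bbbk$ be a field and let $A=\bigoplus_{i\ge 0}A_i$ be a locally finite positively graded $\Bbbk$-algebra, i.e. $A_0\cong\Bbbk\times\cdots\times\Bbbk$ as a $\Bbbk$-algebra and $\dim_{\Bbbk}A_i<\infty$ for all $i\ge 0$. For a complex $X\in D(\mathrm{Gr}_A)$ of ($\mathbb{Z}$-)graded left $A$-modules put $\operatorname{Ext}_A^m(X,A_0)_i=\operatorname{Ext}^m_{\mathrm{Gr}_A}(X,A_0[i])=\operatorname{Hom}_{D(\mathrm{Gr}_A)}(X,A_0[i]\langle m\rangle)$, where $A_0=A/A_{\ge 1}$, $N[i]_j=N_{i+j}$ is the shift of the grading and $\langle m\rangle$ is the shift of complexes. Call $X$ $r$-Ext-regular ($r\in\mathbb{Z}$) if $\operatorname{Ext}_A^m(X,A_0)_i=0$ for all $m\in\mathbb{Z}$ and all $i\le -r-1-m$. Let $\operatorname{Ext-reg}(X)\in\mathbb{Z}\cup\{\pm\infty\}$ be the integer $r$ such that $X$ is $r$-Ext-regular but not $(r-1)$-Ext-regular if there is one, $+\infty$ if $X$ is $r$-Ext-regular for no $r$, and $-\infty$ if it is so for every $r$.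 For complexes of graded right $A$-modules, use the same definitions over the opposite algebra $A^{op}$. Then the Ext-regularity of $A_0$ as a left $A$-module (a complex concentrated in degree $0$) equals its Ext-regularity as a right $A$-module: $$\operatorname{Ext-reg}({}_AA_0)=\operatorname{Ext-reg}((A_0)_A),$$ and this common value is denoted $\operatorname{Ext-reg}A_0$. -/

import Mathlib

open CategoryTheory CategoryTheory.Limits

universe u v

/-- A (ℤ-)graded left module over a positively graded `k`-algebra `A = ⨁ 𝒜 n`: a family of
`k`-vector spaces `M_i`, `i ∈ ℤ`, with `k`-bilinear actions `𝒜 n × M_i → M_{i+n}` that are unital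
and associative. (The target degree is a separate index `j` with a proof of `i + n = j`.) -/
structure GrModule {k : Type u} {A : Type v} [Field k] [Ring A] [Algebra k A]
    (𝒜 : ℕ → Submodule k A) [SetLike.GradedMonoid 𝒜] where
  deg : ℤ → Type v
  [addCommGroup : ∀ i, AddCommGroup (deg i)]
  [module : ∀ i, Module k (deg i)]
  act : ∀ {n : ℕ} {i j : ℤ}, i + n = j → 𝒜 n →ₗ[k] deg i →ₗ[k] deg j
  one_act : ∀ {i : ℤ} (h : i + (0 : ℕ) = i) (x : deg i),
    act h ⟨1, SetLike.GradedOne.one_mem⟩ x = x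
  mul_act : ∀ {m n : ℕ} {i j l : ℤ} (hn : i + n = j) (hm : j + m = l) (hmn : i + (m + n : ℕ) = l)
    (b : 𝒜 m) (a : 𝒜 n) (x : deg i),
    act hmn ⟨b * a, SetLike.GradedMul.mul_mem b.2 a.2⟩ x = act hm b (act hn a x)

attribute [instance] GrModule.addCommGroup GrModule.module

namespace GrModule

variable {k : Type u} {A : Type v} [Field k] [Ring A] [Algebra k A]
  {𝒜 : ℕ → Submodule k A} [SetLike.GradedMonoid 𝒜]

/-- Homomorphisms of graded modules: linear maps homogeneous of degree zero. -/
@[ext]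
structure Hom (M N : GrModule 𝒜) where
  app : ∀ i, M.deg i →ₗ[k] N.deg i
  app_act : ∀ {n : ℕ} {i j : ℤ} (h : i + n = j) (a : 𝒜 n) (x : M.deg i),
    app j (M.act h a x) = N.act h a (app i x)

/-- The category of graded left modules with the homomorphisms of degree zero. -/
instance : Category (GrModule 𝒜) where
  Hom M N := Hom M N
  id M := ⟨fun _ => LinearMap.id, fun _ _ _ => rfl⟩
  comp f g := ⟨fun i => g.app i ∘ₗ f.app i, fun h a x => by simp [f.app_act, g.app_act]⟩

@[ext]
theorem hom_ext {M N : GrModule 𝒜} {f g : M ⟶ N} (h : ∀ i x, f.app i x = g.app i x) : f = g :=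
  Hom.ext (funext fun i => LinearMap.ext (h i))

@[simp]
theorem id_app (M : GrModule 𝒜) (i : ℤ) : Hom.app (𝟙 M) i = LinearMap.id := rfl

@[simp]
theorem comp_app {M N P : GrModule 𝒜} (f : M ⟶ N) (g : N ⟶ P) (i : ℤ) :
    (f ≫ g).app i = g.app i ∘ₗ f.app i := rfl

variable {M N : GrModule 𝒜}

instance : Zero (M ⟶ N) := ⟨⟨fun _ => 0, fun _ _ _ => by simp⟩⟩

instance : Add (M ⟶ N) :=
  ⟨fun f g => ⟨fun i => f.app i + g.app i, fun h a x => by simp [f.app_act, g.app_act]⟩⟩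

instance : Neg (M ⟶ N) := ⟨fun f => ⟨fun i => -f.app i, fun h a x => by simp [f.app_act]⟩⟩

@[simp] theorem zero_app (i : ℤ) : (0 : M ⟶ N).app i = 0 := rfl

@[simp] theorem add_app (f g : M ⟶ N) (i : ℤ) : (f + g).app i = f.app i + g.app i := rfl

@[simp] theorem neg_app (f : M ⟶ N) (i : ℤ) : (-f).app i = -f.app i := rfl

instance : AddCommGroup (M ⟶ N) where
  add_assoc f g h := by ext; simp [add_assoc]
  zero_add f := by ext; simp
  add_zero f := by ext; simp
  add_comm f g := by ext; simp [add_comm]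
  neg_add_cancel f := by ext; simp
  nsmul := nsmulRec
  zsmul := zsmulRec

instance : Preadditive (GrModule 𝒜) where
  add_comp _ _ _ f f' g := by ext; simp
  comp_add _ _ _ f g g' := by ext; simp

/-- The kernel of a homomorphism, degree by degree. -/
def kerObj (f : M ⟶ N) : GrModule 𝒜 where
  deg i := LinearMap.ker (f.app i)
  act {n i j} h := LinearMap.mk₂ k
    (fun a x => ⟨M.act h a x.1, by
      rw [LinearMap.mem_ker, f.app_act, LinearMap.mem_ker.1 x.2, map_zero]⟩)
    (fun _ _ _ => Subtype.ext (by simp)) (fun _ _ _ => Subtype.ext (by simp))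
    (fun _ _ _ => Subtype.ext (by simp)) (fun _ _ _ => Subtype.ext (by simp))
  one_act h x := Subtype.ext (M.one_act h x.1)
  mul_act hn hm hmn b a x := Subtype.ext (M.mul_act hn hm hmn b a x.1)

/-- The inclusion of the kernel. -/
def kerι (f : M ⟶ N) : kerObj f ⟶ M where
  app i := (LinearMap.ker (f.app i)).subtype
  app_act _ _ _ := rfl

theorem kerι_comp (f : M ⟶ N) : kerι f ≫ f = 0 := by
  ext i x
  exact x.2

theorem app_eq_zero {P : GrModule 𝒜} {f : M ⟶ N} {g : N ⟶ P} (w : f ≫ g = 0) (i : ℤ)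
    (x : M.deg i) : g.app i (f.app i x) = 0 := by
  have := congrArg (fun t : M ⟶ P => t.app i x) w
  simpa using this

/-- The universal property of the kernel. -/
def kerIsLimit (f : M ⟶ N) : IsLimit (KernelFork.ofι (kerι f) (kerι_comp f)) :=
  KernelFork.IsLimit.ofι _ _
    (fun {W} (g : W ⟶ M) w =>
      (⟨fun i => (g.app i).codRestrict _ (fun x => app_eq_zero w i x),
        fun h a x => Subtype.ext (g.app_act h a x)⟩ : Hom W (kerObj f)))
    (fun _ _ => rfl)
    (fun {W} g w m hm => by
      subst hm
      rfl)

instance : HasKernels (GrModule 𝒜) := ⟨fun f => ⟨⟨⟨_, kerIsLimit f⟩⟩⟩⟩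

theorem range_act (f : M ⟶ N) {n : ℕ} {i j : ℤ} (h : i + n = j) (a : 𝒜 n) :
    LinearMap.range (f.app i) ≤ (LinearMap.range (f.app j)).comap (N.act h a) := by
  rintro _ ⟨x, rfl⟩
  exact ⟨M.act h a x, f.app_act h a x⟩

/-- The cokernel of a homomorphism, degree by degree. -/
def cokerObj (f : M ⟶ N) : GrModule 𝒜 where
  deg i := N.deg i ⧸ LinearMap.range (f.app i)
  act {n i j} h :=
    { toFun := fun a => Submodule.mapQ _ _ (N.act h a) (range_act f h a)
      map_add' := fun a b => by
        ext x
        simp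
      map_smul' := fun c a => by
        ext x
        simp }
  one_act h x := by
    obtain ⟨x, rfl⟩ := Submodule.mkQ_surjective _ x
    simp [N.one_act h x]
  mul_act hn hm hmn b a x := by
    obtain ⟨x, rfl⟩ := Submodule.mkQ_surjective _ x
    simp [N.mul_act hn hm hmn b a x]

/-- The projection onto the cokernel. -/
def cokerπ (f : M ⟶ N) : N ⟶ cokerObj f where
  app i := (LinearMap.range (f.app i)).mkQ
  app_act _ _ _ := rfl

theorem comp_cokerπ (f : M ⟶ N) : f ≫ cokerπ f = 0 := by
  ext i x
  exact (Submodule.Quotient.mk_eq_zero _).2 ⟨x, rfl⟩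

/-- The universal property of the cokernel. -/
def cokerIsColimit (f : M ⟶ N) : IsColimit (CokernelCofork.ofπ (cokerπ f) (comp_cokerπ f)) :=
  CokernelCofork.IsColimit.ofπ _ _
    (fun {W} (g : N ⟶ W) w =>
      (⟨fun i => Submodule.liftQ _ (g.app i) (by
          rintro _ ⟨x, rfl⟩
          exact app_eq_zero w i x),
        fun h a x => by
          obtain ⟨x, rfl⟩ := Submodule.mkQ_surjective _ x
          exact g.app_act h a x⟩ : Hom (cokerObj f) W))
    (fun _ _ => rfl)
    (fun {W} g w m hm => by
      subst hm
      ext i x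
      obtain ⟨x, rfl⟩ := Submodule.mkQ_surjective _ x
      rfl)

instance : HasCokernels (GrModule 𝒜) := ⟨fun f => ⟨⟨⟨_, cokerIsColimit f⟩⟩⟩⟩

/-- The zero module. -/
def zeroObj : GrModule 𝒜 where
  deg _ := PUnit
  act _ := 0
  one_act _ _ := rfl
  mul_act _ _ _ _ _ _ := rfl

instance : HasZeroObject (GrModule 𝒜) :=
  ⟨⟨zeroObj, (IsZero.iff_id_eq_zero _).2 rfl⟩⟩

/-- The direct sum of two graded modules. -/
def prodObj (M N : GrModule 𝒜) : GrModule 𝒜 where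
  deg i := M.deg i × N.deg i
  act {n i j} h := LinearMap.mk₂ k (fun a x => (M.act h a x.1, N.act h a x.2))
    (fun _ _ _ => by simp) (fun _ _ _ => by simp) (fun _ _ _ => by simp) (fun _ _ _ => by simp)
  one_act h x := Prod.ext (M.one_act h x.1) (N.one_act h x.2)
  mul_act hn hm hmn b a x := Prod.ext (M.mul_act hn hm hmn b a x.1) (N.mul_act hn hm hmn b a x.2)

/-- The direct sum with its projections and injections. -/
def prodBicone (M N : GrModule 𝒜) : BinaryBicone M N where
  pt := prodObj M N
  fst := (⟨fun _ => LinearMap.fst k _ _, fun _ _ _ => rfl⟩ : Hom (prodObj M N) M)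
  snd := (⟨fun _ => LinearMap.snd k _ _, fun _ _ _ => rfl⟩ : Hom (prodObj M N) N)
  inl := (⟨fun _ => LinearMap.inl k _ _, fun h a _ => Prod.ext rfl (map_zero (N.act h a)).symm⟩ :
    Hom M (prodObj M N))
  inr := (⟨fun _ => LinearMap.inr k _ _, fun h a _ => Prod.ext (map_zero (M.act h a)).symm rfl⟩ :
    Hom N (prodObj M N))
  inl_fst := rfl
  inl_snd := rfl
  inr_fst := rfl
  inr_snd := rfl

instance : HasBinaryBiproducts (GrModule 𝒜) :=
  ⟨fun M N => hasBinaryBiproduct_of_total (prodBicone M N) (by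
    ext i x
    · exact Prod.ext (add_zero x.1) (zero_add x.2))⟩

instance : HasFiniteProducts (GrModule 𝒜) :=
  hasFiniteProducts_of_has_binary_and_terminal

theorem injective_of_mono (f : M ⟶ N) [Mono f] (i : ℤ) : Function.Injective (f.app i) := by
  rw [injective_iff_map_eq_zero]
  intro x hx
  have h : kerι f = 0 := (cancel_mono f).1 (by rw [kerι_comp, zero_comp])
  exact congrArg (fun t : kerObj f ⟶ M => t.app i ⟨x, hx⟩) h

theorem surjective_of_epi (f : M ⟶ N) [Epi f] (i : ℤ) : Function.Surjective (f.app i) := by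
  intro y
  have h : cokerπ f = 0 := (cancel_epi f).1 (by rw [comp_cokerπ, comp_zero])
  have h' := congrArg (fun t : N ⟶ cokerObj f => t.app i y) h
  exact (Submodule.Quotient.mk_eq_zero _).1 h'

/-- A monomorphism is the kernel of its cokernel. -/
@[reducible] noncomputable def normalMono (f : M ⟶ N) [Mono f] : NormalMono f where
  Z := cokerObj f
  g := cokerπ f
  w := comp_cokerπ f
  isLimit := KernelFork.IsLimit.ofι' _ _ (fun {W} g w => by
    have hg : ∀ i x, g.app i x ∈ LinearMap.range (f.app i) := fun i x =>
      (Submodule.Quotient.mk_eq_zero _).1 (app_eq_zero w i x)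
    have hl : ∀ i x, f.app i
        ((LinearEquiv.ofInjective (f.app i) (injective_of_mono f i)).symm ⟨g.app i x, hg i x⟩) =
          g.app i x := fun i x => by
      have := (LinearEquiv.ofInjective (f.app i) (injective_of_mono f i)).apply_symm_apply
        ⟨g.app i x, hg i x⟩
      exact congrArg Subtype.val this
    exact ⟨(⟨fun i => (LinearEquiv.ofInjective (f.app i) (injective_of_mono f i)).symm.toLinearMap
        ∘ₗ (g.app i).codRestrict _ (hg i), fun h a x => by
          apply injective_of_mono f
          rw [f.app_act]
          exact (hl _ _).trans ((g.app_act h a x).trans (congrArg _ (hl _ _).symm))⟩ : Hom W M),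
      by
        ext i x
        exact hl i x⟩)

/-- An epimorphism is the cokernel of its kernel. -/
@[reducible] noncomputable def normalEpi (f : M ⟶ N) [Epi f] : NormalEpi f where
  W := kerObj f
  g := kerι f
  w := kerι_comp f
  isColimit := CokernelCofork.IsColimit.ofπ' _ _ (fun {W} g w => by
    have hg : ∀ i, LinearMap.ker (f.app i) ≤ LinearMap.ker (g.app i) := fun i x hx =>
      app_eq_zero w i ⟨x, hx⟩
    have hl : ∀ i x, (Submodule.liftQ _ (g.app i) (hg i))
        (((f.app i).quotKerEquivOfSurjective (surjective_of_epi f i)).symm (f.app i x)) =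
          g.app i x := fun i x => by
      rw [LinearMap.quotKerEquivOfSurjective_symm_apply]
      rfl
    exact ⟨(⟨fun i => Submodule.liftQ _ (g.app i) (hg i) ∘ₗ
        ((f.app i).quotKerEquivOfSurjective (surjective_of_epi f i)).symm.toLinearMap,
        fun {n i j} h a y => by
          obtain ⟨x, rfl⟩ := surjective_of_epi f i y
          rw [← f.app_act]
          exact (hl _ _).trans ((g.app_act h a x).trans (congrArg _ (hl _ _).symm))⟩ : Hom N W),
      by
        ext i x
        exact hl i x⟩)

noncomputable instance : Abelian (GrModule 𝒜) where
  normalMonoOfMono f _ := ⟨normalMono f⟩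
  normalEpiOfEpi f _ := ⟨normalEpi f⟩

/-- The derived category `D(Gr_A)` is the localization of the category of complexes of graded
modules at the quasi-isomorphisms. -/
noncomputable instance : HasDerivedCategory.{max u (v + 1)} (GrModule 𝒜) :=
  HasDerivedCategory.standard _

/-- The shift `M[s]` of a graded module: `M[s]_i = M_{s+i}`. -/
def shift (M : GrModule 𝒜) (s : ℤ) : GrModule 𝒜 where
  deg i := M.deg (s + i)
  act h := M.act (by rw [add_assoc, h])
  one_act _ x := M.one_act _ x
  mul_act _ _ _ b a x := M.mul_act _ _ _ b a x

variable (𝒜) in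
/-- The homogeneous components of `A₀`: all of `𝒜 0` in degree `0`, and zero in other degrees. -/
def zeroDeg (i : ℤ) : Submodule k A := if i = 0 then 𝒜 0 else ⊥

theorem mul_mem_zeroDeg {n : ℕ} {i j : ℤ} (h : i + n = j) {a x : A} (ha : a ∈ 𝒜 n)
    (hx : x ∈ zeroDeg 𝒜 i) : (if n = 0 then a * x else 0) ∈ zeroDeg 𝒜 j := by
  split_ifs with hn
  · subst hn
    obtain rfl : i = j := by simpa using h
    by_cases hi : i = 0
    · simp only [zeroDeg, hi, if_true] at hx ⊢
      simpa using SetLike.GradedMul.mul_mem (A := 𝒜) ha hx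
    · simp only [zeroDeg, hi, if_false, Submodule.mem_bot] at hx ⊢
      rw [hx, mul_zero]
  · exact zero_mem _

variable (𝒜) in
/-- `A₀ = A / A_{≥ 1}` as a graded left module concentrated in degree `0`: elements of `𝒜 0` act by
left multiplication and those of `𝒜 n`, `n > 0`, act by zero. -/
def degreeZero : GrModule 𝒜 where
  deg i := zeroDeg 𝒜 i
  act {n i j} h := LinearMap.mk₂ k
    (fun a x => ⟨if n = 0 then (a : A) * x else 0, mul_mem_zeroDeg h a.2 x.2⟩)
    (fun _ _ _ => Subtype.ext (by simp only [Submodule.coe_add]; split_ifs <;> simp [add_mul]))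
    (fun _ _ _ => Subtype.ext (by simp))
    (fun _ _ _ => Subtype.ext (by simp only [Submodule.coe_add]; split_ifs <;> simp [mul_add]))
    (fun _ _ _ => Subtype.ext (by simp))
  one_act _ x := Subtype.ext (by simp)
  mul_act {m n i j l} hn hm hmn b a x := by
    apply Subtype.ext
    by_cases hm : m = 0 <;> by_cases hn : n = 0 <;> simp [hm, hn, mul_assoc]

end GrModule

section ExtRegularity

variable {k : Type u} {A : Type v} [Field k] [Ring A] [Algebra k A]
  {𝒜 : ℕ → Submodule k A} [SetLike.GradedMonoid 𝒜]

/-- The degree `i` component of the graded Ext: `Ext_A^m(X, N)_i = Ext^m_{Gr_A}(X, N[i])`, which is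
`Hom_{D(Gr_A)}(X, N[i]⟦m⟧)`, for a complex `X` of graded modules and a graded module `N`
(`⟦m⟧` is the shift of complexes). -/
abbrev GrExt (X : DerivedCategory (GrModule 𝒜)) (N : GrModule 𝒜) (m i : ℤ) : Type _ :=
  X ⟶ ((DerivedCategory.singleFunctor (GrModule 𝒜) 0).obj (N.shift i))⟦m⟧

/-- `X` is `r`-Ext-regular: `Ext_A^m(X, A₀)_{≤ -r-1-m} = 0` for all `m`. -/
def IsExtRegular (X : DerivedCategory (GrModule 𝒜)) (r : ℤ) : Prop :=
  ∀ m i : ℤ, i ≤ -r - 1 - m → ∀ e : GrExt X (GrModule.degreeZero 𝒜) m i, e = 0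

/-- The Ext-regularity of a complex of graded modules: the least `r` for which `X` is
`r`-Ext-regular, with value `∞` if there is no such `r` and `-∞` if every `r` is such. -/
noncomputable def extReg (X : DerivedCategory (GrModule 𝒜)) : EReal :=
  ⨅ (r : ℤ) (_ : IsExtRegular X r), ((r : ℝ) : EReal)

theorem IsExtRegular.mono {X : DerivedCategory (GrModule 𝒜)} {r s : ℤ} (h : IsExtRegular X r)
    (hrs : r ≤ s) : IsExtRegular X s :=
  fun m i hi e => h m i (by lia) e

theorem extReg_eq_coe {X : DerivedCategory (GrModule 𝒜)} {r : ℤ} (h : IsExtRegular X r)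
    (h' : ¬ IsExtRegular X (r - 1)) : extReg X = ((r : ℝ) : EReal) := by
  refine le_antisymm (iInf₂_le r h) (le_iInf₂ fun s hs => ?_)
  have : r ≤ s := by
    by_contra hlt
    exact h' (hs.mono (by lia))
  exact_mod_cast this

theorem extReg_eq_top {X : DerivedCategory (GrModule 𝒜)} (h : ∀ r, ¬ IsExtRegular X r) :
    extReg X = ⊤ := by
  simp [extReg, h]

theorem extReg_eq_bot {X : DerivedCategory (GrModule 𝒜)} (h : ∀ r, IsExtRegular X r) :
    extReg X = ⊥ := by
  refine EReal.eq_bot_iff_forall_lt _ |>.2 fun y => ?_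
  obtain ⟨n, hn⟩ := exists_int_lt y
  exact (iInf₂_le n (h n)).trans_lt (by exact_mod_cast hn)

/-- The Ext-regularity of the complex with `A₀` in cohomological degree `0`. -/
noncomputable def extRegDegreeZero (𝒜 : ℕ → Submodule k A) [SetLike.GradedMonoid 𝒜] : EReal :=
  extReg ((DerivedCategory.singleFunctor (GrModule 𝒜) 0).obj (GrModule.degreeZero 𝒜))

end ExtRegularity

section Opposite

variable {k : Type u} {A : Type v} [Field k] [Ring A] [Algebra k A]

/-- The grading of the opposite algebra `Aᵐᵒᵖ`; graded right `A`-modules are graded left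
`Aᵐᵒᵖ`-modules. -/
def opGrading (𝒜 : ℕ → Submodule k A) (n : ℕ) : Submodule k Aᵐᵒᵖ :=
  (𝒜 n).comap (MulOpposite.opLinearEquiv k).symm.toLinearMap

instance (𝒜 : ℕ → Submodule k A) [SetLike.GradedMonoid 𝒜] :
    SetLike.GradedMonoid (opGrading 𝒜) where
  one_mem := SetLike.GradedOne.one_mem (A := 𝒜)
  mul_mem i j a b ha hb := by
    have := SetLike.GradedMul.mul_mem (A := 𝒜) hb ha
    rwa [add_comm] at this

end Opposite

/-- A locally finite positively graded `k`-algebra: `A = ⨁_{n ≥ 0} A_n` with every `A_n` of finite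
dimension and `A₀` isomorphic as a `k`-algebra to a finite product `k × ⋯ × k`. -/
structure IsLocallyFinitePositivelyGraded {k : Type u} {A : Type v} [Field k] [Ring A] [Algebra k A]
    (𝒜 : ℕ → Submodule k A) [GradedAlgebra 𝒜] : Prop where
  finite : ∀ n, Module.Finite k (𝒜 n)
  zero : ∃ d : ℕ, Nonempty (𝒜 0 ≃ₐ[k] (Fin d → k))

/-! The reason is linear duality. For an anti-isomorphism of graded algebras `𝒜` and `ℬ` (here `ℬ`
is the opposite of `𝒜`), the graded dual with shift `s` turns graded `ℬ`-modules into graded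
`𝒜`-modules and conversely. A pairing of an `𝒜`-module with a `ℬ`-module can be read from either
side, so the two contravariant functors are adjoint to each other (`dualAdjunction`). Duals of
vector spaces are exact, so no finiteness or reflexivity is needed for this adjunction to transport
vanishing of `Ext` (`Ext.subsingleton_iff_of_adjunction`).

Since `𝒜 0` is a finite product of copies of the field, the sum of coordinates is a perfect trace
form. It identifies the shift by `s` of the degree-zero module on one side with the dual of the
degree-zero module on the other (`isIso_degreeZeroToDual`). Hence `Ext^n(A₀, A₀[s])` vanishes for
left modules exactly when it does for right modules. Regularity depends only on this vanishing:
negative Ext groups are zero, and the others are the `Ext` of the abelian category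
(`isExtRegular_single_iff`). -/

/-! ### Vanishing of Ext across a contravariant adjunction -/

section ExtDuality

open CategoryTheory.Abelian Opposite

universe w w' v₁ v₂ u₁ u₂

variable {C₁ : Type u₁} [Category.{v₁} C₁] [Abelian C₁]
  {C₂ : Type u₂} [Category.{v₂} C₂] [Abelian C₂]

/-- A right adjoint is left exact, and preservation of epimorphisms supplies the missing right end.
-/
theorem CategoryTheory.ShortComplex.ShortExact.map_of_rightAdjoint {F : C₁ ⥤ C₂ᵒᵖ}
    {D : C₂ᵒᵖ ⥤ C₁} [D.Additive] (adj : F ⊣ D) [D.PreservesEpimorphisms]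
    {S : ShortComplex C₂} (hS : S.ShortExact) : (S.op.map D).ShortExact := by
  have : PreservesFiniteLimits D := by
    have := adj.rightAdjoint_preservesLimits
    exact PreservesLimits.preservesFiniteLimits D
  have hop := hS.op
  have := hop.mono_f
  have := hop.epi_g
  have : Mono (S.op.map D).f := inferInstanceAs (Mono (D.map S.op.f))
  have : Epi (S.op.map D).g := inferInstanceAs (Epi (D.map S.op.g))
  exact { exact := hop.exact.map_of_mono_of_preservesKernel D hop.mono_f inferInstance }

variable [HasExt.{w} C₁] [HasExt.{w'} C₂]

/-- Dimension shifting: the long exact sequence makes the connecting map an isomorphism, because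
positive Ext groups into the injective middle term vanish. -/
theorem CategoryTheory.Abelian.Ext.subsingleton_succ_iff_covariant {X : C₁} {S : ShortComplex C₁}
    (hS : S.ShortExact) [Injective S.X₂] (n : ℕ) :
    Subsingleton (Ext X S.X₁ (n + 2)) ↔ Subsingleton (Ext X S.X₃ (n + 1)) := by
  constructor
  · intro h
    refine subsingleton_of_forall_eq 0 fun x => ?_
    obtain ⟨y, rfl⟩ := Ext.covariant_sequence_exact₃ X hS x rfl (Subsingleton.elim _ _)
    rw [Ext.eq_zero_of_injective y, Ext.zero_comp]
  · intro h
    refine subsingleton_of_forall_eq 0 fun x => ?_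
    obtain ⟨y, rfl⟩ := Ext.covariant_sequence_exact₁ X hS x (Ext.eq_zero_of_injective _) rfl
    rw [Subsingleton.elim y 0, Ext.zero_comp]

theorem CategoryTheory.Abelian.Ext.subsingleton_succ_iff_contravariant {Y : C₁}
    {S : ShortComplex C₁} (hS : S.ShortExact) [Projective S.X₂] (n : ℕ) :
    Subsingleton (Ext S.X₃ Y (n + 2)) ↔ Subsingleton (Ext S.X₁ Y (n + 1)) := by
  constructor
  · intro h
    refine subsingleton_of_forall_eq 0 fun x => ?_
    obtain ⟨y, rfl⟩ := Ext.contravariant_sequence_exact₁ hS Y x (add_comm 1 (n + 1))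
      (Subsingleton.elim _ _)
    rw [Ext.eq_zero_of_projective y, Ext.comp_zero]
  · intro h
    refine subsingleton_of_forall_eq 0 fun x => ?_
    obtain ⟨y, rfl⟩ := Ext.contravariant_sequence_exact₃ hS Y x (Ext.eq_zero_of_projective _)
      (add_comm 1 (n + 1))
    rw [Subsingleton.elim y 0, Ext.comp_zero]

/-- `Ext¹` is here the cokernel of a map of Hom groups, so its vanishing is a lifting property. In
this form it can be carried through the Hom bijection of an adjunction, which vanishing of Hom
groups alone would not allow. -/
theorem CategoryTheory.Abelian.Ext.subsingleton_one_iff_covariant {X : C₁} {S : ShortComplex C₁}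
    (hS : S.ShortExact) [Injective S.X₂] :
    Subsingleton (Ext X S.X₁ 1) ↔ ∀ g : X ⟶ S.X₃, ∃ t : X ⟶ S.X₂, t ≫ S.g = g := by
  constructor
  · intro h g
    obtain ⟨y, hy⟩ := Ext.covariant_sequence_exact₃ X hS (Ext.mk₀ g) (zero_add 1)
      (Subsingleton.elim _ _)
    obtain ⟨t, rfl⟩ := (Ext.mk₀_bijective _ _).2 y
    rw [Ext.mk₀_comp_mk₀] at hy
    exact ⟨t, (Ext.mk₀_bijective _ _).1 hy⟩
  · intro h
    refine subsingleton_of_forall_eq 0 fun x => ?_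
    obtain ⟨y, rfl⟩ := Ext.covariant_sequence_exact₁ X hS x (Ext.eq_zero_of_injective _)
      (zero_add 1)
    obtain ⟨g, rfl⟩ := (Ext.mk₀_bijective _ _).2 y
    obtain ⟨t, rfl⟩ := h g
    rw [← Ext.mk₀_comp_mk₀, Ext.comp_assoc (h₁₂ := add_zero 0) (h₂₃ := zero_add 1)
      (h := by simp), hS.comp_extClass, Ext.comp_zero]

theorem CategoryTheory.Abelian.Ext.subsingleton_one_iff_contravariant {Y : C₁}
    {S : ShortComplex C₁} (hS : S.ShortExact) [Projective S.X₂] :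
    Subsingleton (Ext S.X₃ Y 1) ↔ ∀ g : S.X₁ ⟶ Y, ∃ t : S.X₂ ⟶ Y, S.f ≫ t = g := by
  constructor
  · intro h g
    obtain ⟨y, hy⟩ := Ext.contravariant_sequence_exact₁ hS Y (Ext.mk₀ g) (add_zero 1)
      (Subsingleton.elim _ _)
    obtain ⟨t, rfl⟩ := (Ext.mk₀_bijective _ _).2 y
    rw [Ext.mk₀_comp_mk₀] at hy
    exact ⟨t, (Ext.mk₀_bijective _ _).1 hy⟩
  · intro h
    refine subsingleton_of_forall_eq 0 fun x => ?_
    obtain ⟨y, rfl⟩ := Ext.contravariant_sequence_exact₃ hS Y x (Ext.eq_zero_of_projective _)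
      (add_zero 1)
    obtain ⟨g, rfl⟩ := (Ext.mk₀_bijective _ _).2 y
    obtain ⟨t, rfl⟩ := h g
    rw [← Ext.mk₀_comp_mk₀, hS.extClass_comp_assoc]

/-- A contravariant adjunction between exact functors of abelian categories preserves and reflects
the vanishing of `Ext`. -/
theorem CategoryTheory.Abelian.Ext.subsingleton_iff_of_adjunction {F : C₁ ⥤ C₂ᵒᵖ} {D : C₂ᵒᵖ ⥤ C₁}
    [D.Additive] (adj : F ⊣ D) [F.PreservesMonomorphisms] [D.PreservesEpimorphisms]
    [EnoughProjectives C₂] (X : C₁) (n : ℕ) (Y : C₂) :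
    Subsingleton (Ext X (D.obj (op Y)) n) ↔ Subsingleton (Ext Y (F.obj X).unop n) := by
  -- A projective cover of `Y` by one term with its syzygy `S.X₁`; the induction passes from `Y` to
  -- this syzygy.
  have step : ∀ Y : C₂, ∃ S : ShortComplex C₂, S.ShortExact ∧ Projective S.X₂ ∧ S.X₃ = Y := by
    intro Y
    refine ⟨ShortComplex.mk (kernel.ι (Projective.π Y)) (Projective.π Y) (by simp), ?_,
      Projective.projective_over Y, rfl⟩
    exact { exact := ShortComplex.exact_kernel _, mono_f := inferInstanceAs (Mono (kernel.ι _)),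
            epi_g := inferInstanceAs (Epi (Projective.π Y)) }
  induction n generalizing Y with
  | zero =>
    rw [Ext.homEquiv₀.subsingleton_congr, Ext.homEquiv₀.subsingleton_congr,
      ← (adj.homEquiv X (op Y)).subsingleton_congr, (opEquiv (F.obj X) (op Y)).subsingleton_congr]
  | succ n ih =>
    obtain ⟨S, hS, hP, rfl⟩ := step Y
    have hT := hS.map_of_rightAdjoint adj
    -- A projective of `C₂` is injective in `C₂ᵒᵖ`, and `D` preserves injectives because its left
    -- adjoint `F` preserves monomorphisms.
    have : Injective (S.op.map D).X₂ := Injective.injective_of_adjoint adj (op S.X₂)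
    cases n with
    | zero =>
      -- Degree one is a base case of its own: naturality of the adjunction matches lifts along
      -- `D.map S.f.op` with extensions along `S.f`.
      refine (Ext.subsingleton_one_iff_covariant hT).trans
        (Iff.trans ?_ (Ext.subsingleton_one_iff_contravariant hS).symm)
      constructor
      · intro h g
        obtain ⟨t, ht⟩ := h (adj.homEquiv X (op S.X₁) g.op)
        refine ⟨((adj.homEquiv X (op S.X₂)).symm t).unop, Quiver.Hom.op_inj ?_⟩
        apply (adj.homEquiv X (op S.X₁)).injective
        rw [← ht]
        erw [op_comp, adj.homEquiv_naturality_right]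
        exact congrArg (· ≫ D.map S.f.op) (Equiv.apply_symm_apply _ _)
      · intro h g
        obtain ⟨t, ht⟩ := h ((adj.homEquiv X (op S.X₁)).symm g).unop
        refine ⟨adj.homEquiv X (op S.X₂) t.op, ?_⟩
        apply (adj.homEquiv X (op S.X₁)).symm.injective
        apply Quiver.Hom.unop_inj
        erw [adj.homEquiv_naturality_right_symm, ← ht]
        simp
    | succ n =>
      exact (Ext.subsingleton_succ_iff_covariant hT n).trans
        ((ih S.X₁).trans (Ext.subsingleton_succ_iff_contravariant hS n).symm)

end ExtDuality

/-! ### Degreewise criteria for graded modules -/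

namespace GrModule

variable {k : Type u} {A : Type v} [Field k] [Ring A] [Algebra k A]
  {𝒜 : ℕ → Submodule k A}

section Basic

variable [SetLike.GradedMonoid 𝒜]

theorem mono_of_injective {M N : GrModule 𝒜} (f : M ⟶ N)
    (h : ∀ i, Function.Injective (f.app i)) : Mono f := by
  refine ⟨fun g g' w => ?_⟩
  ext i x
  apply h i
  exact congrArg (fun t : Hom _ N => t.app i x) w

theorem epi_of_surjective {M N : GrModule 𝒜} (f : M ⟶ N)
    (h : ∀ i, Function.Surjective (f.app i)) : Epi f := by
  refine ⟨fun g g' w => ?_⟩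
  ext i y
  obtain ⟨x, rfl⟩ := h i y
  exact congrArg (fun t : Hom M _ => t.app i x) w

theorem isIso_of_bijective {M N : GrModule 𝒜} (f : M ⟶ N)
    (h : ∀ i, Function.Bijective (f.app i)) : IsIso f := by
  have := mono_of_injective f fun i => (h i).1
  have := epi_of_surjective f fun i => (h i).2
  exact isIso_of_mono_of_epi f

/-- Absorbs the transport between degrees such as `m + n` and `n + m`, which are equal only
propositionally. -/
theorem act_congr (M : GrModule 𝒜) {m n : ℕ} {i j : ℤ} (hm : i + m = j) (hn : i + n = j)
    {a : 𝒜 m} {b : 𝒜 n} (hab : (a : A) = b) (x : M.deg i) : M.act hm a x = M.act hn b x := by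
  obtain rfl : m = n := by lia
  rw [Subtype.ext hab]

end Basic

/-! ### Induced modules and enough projectives -/

section Induced

open TensorProduct

variable (V : ℤ → Type v) [∀ i, AddCommGroup (V i)] [∀ i, Module k (V i)]

variable (𝒜) in
/-- The degree `j` component `⨁_{i + n = j} 𝒜 n ⊗ V i` of `A ⊗ V`. -/
abbrev InducedDeg (j : ℤ) : Type v :=
  DirectSum {p : ℕ × ℤ // p.2 + p.1 = j} fun p => 𝒜 p.1.1 ⊗[k] V p.1.2

variable {V} in
/-- The homogeneous pure tensor `b ⊗ x`. -/
def inducedMk {n : ℕ} {i j : ℤ} (h : i + n = j) (b : 𝒜 n) (x : V i) : InducedDeg 𝒜 V j :=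
  DirectSum.lof k {p : ℕ × ℤ // p.2 + p.1 = j} (fun p => 𝒜 p.1.1 ⊗[k] V p.1.2) ⟨(n, i), h⟩
    (b ⊗ₜ x)

variable {V} in
theorem inducedMk_congr {m n : ℕ} {i j : ℤ} (hm : i + m = j) (hn : i + n = j)
    {a : 𝒜 m} {b : 𝒜 n} (hab : (a : A) = b) (x : V i) : inducedMk hm a x = inducedMk hn b x := by
  obtain rfl : m = n := by lia
  rw [Subtype.ext hab]

variable {V} in
theorem induced_hom_ext {j : ℤ} {W : Type*} [AddCommMonoid W] [Module k W]
    {f g : InducedDeg 𝒜 V j →ₗ[k] W}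
    (h : ∀ (n : ℕ) (i : ℤ) (hj : i + n = j) (b : 𝒜 n) (x : V i),
      f (inducedMk hj b x) = g (inducedMk hj b x)) : f = g := by
  refine DirectSum.linearMap_ext k fun p => TensorProduct.ext' fun b x => ?_
  exact h _ _ p.2 b x

/-- The linear map out of `A ⊗ V` in degree `j` with given values on pure tensors. -/
def inducedLift {j : ℤ} {W : Type*} [AddCommMonoid W] [Module k W]
    (f : ∀ (n : ℕ) (i : ℤ), i + n = j → 𝒜 n →ₗ[k] V i →ₗ[k] W) : InducedDeg 𝒜 V j →ₗ[k] W :=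
  DirectSum.toModule k _ _ fun p => TensorProduct.lift (f p.1.1 p.1.2 p.2)

@[simp]
theorem inducedLift_mk {j : ℤ} {W : Type*} [AddCommMonoid W] [Module k W]
    (f : ∀ (n : ℕ) (i : ℤ), i + n = j → 𝒜 n →ₗ[k] V i →ₗ[k] W) {n : ℕ} {i : ℤ}
    (h : i + n = j) (b : 𝒜 n) (x : V i) : inducedLift V f (inducedMk h b x) = f n i h b x := by
  simp [inducedLift, inducedMk]

/-- Pure tensors as a bilinear map. -/
def inducedMkₗ {n : ℕ} {i j : ℤ} (h : i + n = j) : 𝒜 n →ₗ[k] V i →ₗ[k] InducedDeg 𝒜 V j :=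
  LinearMap.mk₂ k (inducedMk h) (fun _ _ _ => by simp [inducedMk, add_tmul])
    (fun _ _ _ => by simp only [inducedMk, ← smul_tmul', map_smul])
    (fun _ _ _ => by simp [inducedMk, tmul_add]) (fun _ _ _ => by simp [inducedMk])

@[simp]
theorem inducedMkₗ_apply {n : ℕ} {i j : ℤ} (h : i + n = j) (b : 𝒜 n) (x : V i) :
    inducedMkₗ V h b x = inducedMk h b x := rfl

variable [SetLike.GradedMonoid 𝒜]

variable (𝒜) in
/-- Multiplication of homogeneous elements. -/
def gradedMul (m n : ℕ) : 𝒜 m →ₗ[k] 𝒜 n →ₗ[k] 𝒜 (m + n) :=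
  LinearMap.mk₂ k (fun a b => ⟨a * b, SetLike.GradedMul.mul_mem a.2 b.2⟩)
    (fun _ _ _ => Subtype.ext (by simp [add_mul])) (fun _ _ _ => Subtype.ext (by simp))
    (fun _ _ _ => Subtype.ext (by simp [mul_add])) (fun _ _ _ => Subtype.ext (by simp))

/-- The action of a homogeneous element on `A ⊗ V`. -/
def inducedAct {m : ℕ} {j l : ℤ} (h : j + m = l) (a : 𝒜 m) :
    InducedDeg 𝒜 V j →ₗ[k] InducedDeg 𝒜 V l :=
  inducedLift V fun n i (hn : i + n = j) =>
    inducedMkₗ V (show i + (m + n : ℕ) = l by push_cast; lia) ∘ₗ gradedMul 𝒜 m n a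

theorem inducedAct_mk {m n : ℕ} {i j l : ℤ} (h : j + m = l) (hn : i + n = j) (a : 𝒜 m) (b : 𝒜 n)
    (x : V i) : inducedAct V h a (inducedMk hn b x) =
      inducedMk (show i + (m + n : ℕ) = l by push_cast; lia) (gradedMul 𝒜 m n a b) x := by
  simp [inducedAct]

variable (𝒜) in
/-- The induced module `A ⊗ V` of a graded vector space `V`. -/
def induced : GrModule 𝒜 where
  deg := InducedDeg 𝒜 V
  addCommGroup _ := Module.addCommMonoidToAddCommGroup k
  act {m j l} h :=
    { toFun := inducedAct V h
      map_add' a b := induced_hom_ext fun n i hn c x => by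
        simp only [inducedAct_mk, LinearMap.add_apply, map_add]
        simp only [← inducedMkₗ_apply, map_add, LinearMap.add_apply]
      map_smul' r a := induced_hom_ext fun n i hn c x => by
        simp only [inducedAct_mk, LinearMap.smul_apply, map_smul, RingHom.id_apply]
        simp only [← inducedMkₗ_apply, map_smul, LinearMap.smul_apply] }
  one_act h x := by
    refine LinearMap.congr_fun (g := LinearMap.id) (induced_hom_ext fun n i hn b y => ?_) x
    exact (inducedAct_mk V h hn _ b y).trans (inducedMk_congr _ _ (by simp [gradedMul]) y)
  mul_act hn hm hmn b a x := by
    refine LinearMap.congr_fun (g := inducedAct V hm b ∘ₗ inducedAct V hn a)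
      (induced_hom_ext fun n i hi c y => ?_) x
    refine (inducedAct_mk V hmn hi _ c y).trans ?_
    rw [LinearMap.comp_apply, inducedAct_mk, inducedAct_mk]
    exact inducedMk_congr _ _ (by simp [gradedMul, mul_assoc]) y

variable {V}

/-- The homomorphism out of an induced module extending linear maps `V i → M i`. -/
def inducedDesc {M : GrModule 𝒜} (f : ∀ i, V i →ₗ[k] M.deg i) : induced 𝒜 V ⟶ M where
  app j := inducedLift V fun n i h => (M.act h).compl₂ (f i)
  app_act {m j l} h a x := by
    refine LinearMap.congr_fun (f := (inducedLift V fun n i h => (M.act h).compl₂ (f i)) ∘ₗ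
      inducedAct V h a) (g := M.act h a ∘ₗ inducedLift V fun n i h => (M.act h).compl₂ (f i))
      (induced_hom_ext fun n i hi c y => ?_) x
    simp only [LinearMap.comp_apply, inducedAct_mk, inducedLift_mk, LinearMap.compl₂_apply]
    exact M.mul_act hi h _ a c _

theorem inducedDesc_mk {M : GrModule 𝒜} (f : ∀ i, V i →ₗ[k] M.deg i) {n : ℕ} {i j : ℤ}
    (h : i + n = j) (b : 𝒜 n) (x : V i) :
    (inducedDesc f).app j (inducedMk h b x) = M.act h b (f i x) :=
  inducedLift_mk V (fun _ i h => (M.act h).compl₂ (f i)) h b x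

/-- The generators `V i` of an induced module. -/
def inducedUnit (i : ℤ) : V i →ₗ[k] (induced 𝒜 V).deg i :=
  inducedMkₗ V (show i + (0 : ℕ) = i by simp) ⟨1, SetLike.GradedOne.one_mem⟩

theorem inducedDesc_unit {M : GrModule 𝒜} (f : ∀ i, V i →ₗ[k] M.deg i) (i : ℤ) (x : V i) :
    (inducedDesc f).app i (inducedUnit i x) = f i x :=
  (inducedDesc_mk f _ _ x).trans (M.one_act _ _)

theorem induced_ext {M : GrModule 𝒜} {f g : induced 𝒜 V ⟶ M}
    (h : ∀ i x, f.app i (inducedUnit i x) = g.app i (inducedUnit i x)) : f = g := by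
  refine Hom.ext (funext fun j => induced_hom_ext fun n i hn b x => ?_)
  -- `b ⊗ x = b · (1 ⊗ x)`, so the generators determine a homomorphism.
  have key : inducedMk hn b x = (induced 𝒜 V).act hn b (inducedUnit i x) :=
    (inducedMk_congr _ _ (by simp [gradedMul]) x).trans (inducedAct_mk V hn _ b _ x).symm
  rw [key]
  exact (f.app_act hn b _).trans ((congrArg _ (h i x)).trans (g.app_act hn b _).symm)

/-- Vector spaces are projective, so the generators lift degree by degree; the lifts extend to a
homomorphism by the universal property. -/
instance : Projective (induced 𝒜 V) where
  factors {E X} φ e _ := by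
    have := fun i => Module.projective_lifting_property (e.app i) (φ.app i ∘ₗ inducedUnit i)
      (surjective_of_epi e i)
    choose t ht using this
    refine ⟨inducedDesc t, induced_ext fun i x => ?_⟩
    exact (congrArg (e.app i) (inducedDesc_unit t i x)).trans (LinearMap.congr_fun (ht i) x)

instance : EnoughProjectives (GrModule 𝒜) where
  presentation N := ⟨{
    p := induced 𝒜 N.deg
    f := inducedDesc fun _ => LinearMap.id
    epi := epi_of_surjective _ fun i x => ⟨inducedUnit i x, inducedDesc_unit _ i x⟩ }⟩

end Induced

end GrModule

/-! ### Graded duality over anti-isomorphic algebras -/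

/-- A `k`-linear anti-homomorphism of graded algebras. -/
structure GradedAntihom {k : Type u} {A B : Type v} [Field k] [Ring A] [Algebra k A] [Ring B]
    [Algebra k B] (𝒜 : ℕ → Submodule k A) (ℬ : ℕ → Submodule k B) where
  toLinearMap : A →ₗ[k] B
  map_one : toLinearMap 1 = 1
  map_mul : ∀ a b, toLinearMap (a * b) = toLinearMap b * toLinearMap a
  map_mem : ∀ {n a}, a ∈ 𝒜 n → toLinearMap a ∈ ℬ n

namespace GrModule

open Opposite

variable {k : Type u} {A B : Type v} [Field k] [Ring A] [Algebra k A] [Ring B] [Algebra k B]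
  {𝒜 : ℕ → Submodule k A} {ℬ : ℕ → Submodule k B}

/-- The homogeneous components of an anti-homomorphism. -/
def _root_.GradedAntihom.component (σ : GradedAntihom 𝒜 ℬ) (n : ℕ) : 𝒜 n →ₗ[k] ℬ n :=
  σ.toLinearMap.restrict fun _ => σ.map_mem

variable [SetLike.GradedMonoid ℬ] (σ : GradedAntihom 𝒜 ℬ)
  (K : Type v) [AddCommGroup K] [Module k K] (s : ℤ)

/-- The action on the graded dual. -/
def dualAct (N : GrModule ℬ) {n : ℕ} {j l : ℤ} (h : j + n = l) (a : 𝒜 n)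
    (φ : ∀ i : {i : ℤ // s + i + j = 0}, N.deg i →ₗ[k] K) :
    ∀ i : {i : ℤ // s + i + l = 0}, N.deg i →ₗ[k] K :=
  fun i => φ ⟨i + n, by have := i.2; lia⟩ ∘ₗ N.act rfl (σ.component n a)

variable {K s} in
-- The product over `{i // s + i + j = 0}` has the single index `-s - j`; indexing by a subtype lets
-- the degree be any `q` provably equal to `i + n`, without casts.
theorem dualAct_apply {N : GrModule ℬ} {n : ℕ} {j l : ℤ} (h : j + n = l) (a : 𝒜 n)
    (φ : ∀ i : {i : ℤ // s + i + j = 0}, N.deg i →ₗ[k] K) (i : {i : ℤ // s + i + l = 0}) {q : ℤ}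
    (hq : i.1 + n = q) (hq' : s + q + j = 0) (y : N.deg i) :
    dualAct σ K s N h a φ i y = φ ⟨q, hq'⟩ (N.act hq (σ.component n a) y) := by
  subst hq
  rfl

variable [SetLike.GradedMonoid 𝒜]

/-- The `K`-valued graded dual of a graded `ℬ`-module, with grading shifted by `s`, as a graded
`𝒜`-module. -/
def dualObj (N : GrModule ℬ) : GrModule 𝒜 where
  deg j := ∀ i : {i : ℤ // s + i + j = 0}, N.deg i →ₗ[k] K
  act h := LinearMap.mk₂ k (dualAct σ K s N h)
    (fun _ _ _ => by ext; simp [dualAct]) (fun _ _ _ => by ext; simp [dualAct])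
    (fun _ _ _ => by ext; simp [dualAct]) (fun _ _ _ => by ext; simp [dualAct])
  one_act h φ := by
    ext i y
    refine (dualAct_apply σ h _ φ i (by simp) i.2 y).trans (congrArg (φ i) ?_)
    exact (N.act_congr _ _ σ.map_one y).trans (N.one_act (add_zero _) y)
  mul_act {m n j l r} hn hm hmn b a φ := by
    ext i y
    have hi := i.2
    -- As `σ` reverses products, `σ b` acts on `y` before `σ a`; hence the intermediate degree `i +
    -- m`.
    refine (dualAct_apply σ hmn _ φ i (q := i + m + n) (by push_cast; lia) (by lia) y).trans ?_
    refine Eq.trans ?_ (dualAct_apply σ hm b _ i (q := i + m) rfl (by lia) y).symm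
    refine Eq.trans ?_ (dualAct_apply σ hn a φ ⟨i + m, _⟩ (q := i + m + n) rfl (by lia) _).symm
    refine congrArg _ (Eq.trans ?_ (N.mul_act rfl rfl (by push_cast; lia) _ _ y))
    exact N.act_congr _ _ (σ.map_mul _ _) y

theorem dualObj_act_apply (N : GrModule ℬ) {n : ℕ} {j l : ℤ} (h : j + n = l) (a : 𝒜 n)
    (φ : (dualObj σ K s N).deg j) (i : {i : ℤ // s + i + l = 0}) {q : ℤ}
    (hq : i.1 + n = q) (hq' : s + q + j = 0) (y : N.deg i) :
    (dualObj σ K s N).act h a φ i y = φ ⟨q, hq'⟩ (N.act hq (σ.component n a) y) :=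
  dualAct_apply σ h a φ i hq hq' y

/-- The transpose of a homomorphism. -/
def dualMap {N N' : GrModule ℬ} (f : N ⟶ N') : dualObj σ K s N' ⟶ dualObj σ K s N where
  app j := LinearMap.pi fun i => (LinearMap.lcomp k K (f.app i)) ∘ₗ LinearMap.proj i
  app_act h a φ := by
    refine funext fun i => LinearMap.ext fun y => ?_
    have hi := i.2
    refine (dualObj_act_apply σ K s N' h a φ i rfl (by lia) _).trans ?_
    refine Eq.trans ?_ (dualObj_act_apply σ K s N h a _ i rfl (by lia) y).symm
    exact congrArg _ (f.app_act _ _ _).symm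

/-- The graded dual as a contravariant functor. -/
def dual : (GrModule ℬ)ᵒᵖ ⥤ GrModule 𝒜 where
  obj N := dualObj σ K s N.unop
  map f := dualMap σ K s f.unop

instance : (dual σ K s).Additive where
  map_add {N N' f g} := by
    ext j φ
    refine funext fun i => LinearMap.ext fun y => ?_
    exact map_add (φ i) _ _

/-- Injections of vector spaces split, so every functional extends, whatever `K` is. -/
theorem dualMap_surjective {N N' : GrModule ℬ} (f : N ⟶ N') [Mono f] (j : ℤ) :
    Function.Surjective ((dualMap σ K s f).app j) := by
  intro φ
  have := fun i : {i : ℤ // s + i + j = 0} =>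
    LinearMap.exists_leftInverse_of_injective (f.app i)
      (LinearMap.ker_eq_bot.2 (injective_of_mono f i))
  choose g hg using this
  refine ⟨fun i => φ i ∘ₗ g i, funext fun i => LinearMap.ext fun y => ?_⟩
  exact congrArg (φ i) (LinearMap.congr_fun (hg i) y)

instance : (dual σ K s).PreservesEpimorphisms where
  preserves f _ := epi_of_surjective _ (dualMap_surjective σ K s f.unop)

instance : (dual σ K s).rightOp.PreservesMonomorphisms where
  preserves f _ := by
    have : Epi ((dual σ K s).map f.op) := inferInstance
    exact inferInstanceAs (Mono ((dual σ K s).map f.op).op)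

variable {σ} {ρ : GradedAntihom ℬ 𝒜}

/-- Exchange of the arguments of a pairing. -/
def dualFlip (hρσ : ∀ a, ρ.toLinearMap (σ.toLinearMap a) = a) {M : GrModule 𝒜} {N : GrModule ℬ}
    (g : N ⟶ dualObj ρ K s M) : M ⟶ dualObj σ K s N where
  app j := LinearMap.pi fun i =>
    ((LinearMap.proj (R := k) (φ := fun j : {j : ℤ // s + j + i.1 = 0} => M.deg j →ₗ[k] K)
      ⟨j, by have := i.2; lia⟩) ∘ₗ g.app i).flip
  app_act {n j l} h a x := by
    refine funext fun i => LinearMap.ext fun y => ?_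
    have hi := i.2
    refine Eq.trans ?_ (dualObj_act_apply σ K s N h a _ i rfl (by lia) y).symm
    have hg := congrFun (g.app_act (rfl : i.1 + n = i.1 + n) (σ.component n a) y) ⟨j, by lia⟩
    refine Eq.trans ?_ (LinearMap.congr_fun hg x).symm
    refine Eq.trans ?_ (dualObj_act_apply ρ K s M _ _ _ ⟨j, _⟩ h (by lia) x).symm
    -- Passing `a` across the pairing twice gives `ρ (σ a)`, which is `a`.
    exact congrArg _ (M.act_congr _ _ (hρσ a).symm x)

/-- The graded duality between modules over anti-isomorphic algebras. -/
def dualAdjunction (hρσ : ∀ a, ρ.toLinearMap (σ.toLinearMap a) = a)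
    (hσρ : ∀ b, σ.toLinearMap (ρ.toLinearMap b) = b) :
    (dual ρ K s).rightOp ⊣ dual σ K s :=
  Adjunction.mkOfHomEquiv
    { homEquiv _ _ :=
        { toFun f := dualFlip K s hρσ f.unop
          invFun g := Quiver.Hom.op (dualFlip K s hσρ g)
          left_inv _ := rfl
          right_inv _ := rfl }
      homEquiv_naturality_left_symm _ _ := rfl
      homEquiv_naturality_right _ _ := rfl }

end GrModule

/-! ### Trace forms and self-duality of the degree-zero part -/

namespace GrModule

open Opposite CategoryTheory.Abelian

variable {k : Type u} {A B : Type v} [Field k] [Ring A] [Algebra k A] [Ring B] [Algebra k B]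
  {𝒜 : ℕ → Submodule k A} {ℬ : ℕ → Submodule k B}

theorem zeroDeg_of_eq_zero {i : ℤ} (hi : i = 0) : zeroDeg 𝒜 i = 𝒜 0 := if_pos hi

theorem eq_zero_of_mem_zeroDeg {i : ℤ} (hi : i ≠ 0) {x : A} (hx : x ∈ zeroDeg 𝒜 i) : x = 0 := by
  simpa [zeroDeg, hi] using hx

/-- A `K`-valued linear form inducing an isomorphism of `ℬ 0` with its `K`-dual. -/
structure IsPerfectTrace (ℬ : ℕ → Submodule k B) {K : Type v} [AddCommGroup K] [Module k K]
    (τ : B →ₗ[k] K) : Prop where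
  eq_zero : ∀ b ∈ ℬ 0, (∀ y ∈ ℬ 0, τ (b * y) = 0) → b = 0
  exists_eq : ∀ φ : ℬ 0 →ₗ[k] K, ∃ b ∈ ℬ 0, ∀ y : ℬ 0, τ (b * y) = φ y

/-- The form is the sum of coordinates followed by `q`, for which the coordinate idempotents are a
self-dual basis. The condition on `q` is weaker than injectivity so as to include the zero algebra,
where `K` may be zero. -/
theorem exists_isPerfectTrace [SetLike.GradedMonoid ℬ] {K : Type v} [AddCommGroup K] [Module k K]
    {d : ℕ} (ψ : ℬ 0 ≃ₗ[k] (Fin d → k)) (hψ : ∀ x y : ℬ 0, ψ (x * y) = ψ x * ψ y)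
    {q : k →ₗ[k] K} (hq : Function.Surjective q) (hq' : ∀ c, q c = 0 → c • (1 : B) = 0) :
    ∃ τ : B →ₗ[k] K, IsPerfectTrace ℬ τ := by
  obtain ⟨τ, hτ⟩ := LinearMap.exists_extend
    (q ∘ₗ (∑ i, LinearMap.proj i : (Fin d → k) →ₗ[k] k) ∘ₗ ψ.toLinearMap)
  have hτ' : ∀ x y : ℬ 0, τ (x * y) = q (∑ i, ψ x i * ψ y i) := fun x y => by
    have := LinearMap.congr_fun hτ (x * y)
    simpa [hψ] using this
  have hsingle : ∀ c : Fin d → k, c = ∑ i, c i • Pi.single i (1 : k) := fun c => by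
    simpa using pi_eq_sum_univ' c
  refine ⟨τ, ⟨fun b hb h => ?_, fun φ => ?_⟩⟩
  · lift b to ℬ 0 using hb
    -- Pairing `b` with the `i`-th idempotent picks out its `i`-th coordinate.
    have hz : ∀ i, ψ b i • (1 : B) = 0 := fun i => hq' _ <| by
      have := h (ψ.symm (Pi.single i 1)) (ψ.symm _).2
      rw [hτ'] at this
      simpa [Pi.single_apply] using this
    have hb : b = ∑ i, ψ b i • ψ.symm (Pi.single i 1) := by
      apply ψ.injective
      simpa using hsingle (ψ b)
    rw [hb]
    simp only [AddSubmonoidClass.coe_finsetSum, Submodule.coe_smul]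
    refine Finset.sum_eq_zero fun i _ => ?_
    rw [← one_mul ((ψ.symm (Pi.single i 1) : ℬ 0) : B), ← smul_mul_assoc, hz, zero_mul]
  -- The representing element has as coordinates lifts along `q` of the values of `φ` on the
  -- idempotents.
  · choose c hc using fun i => hq (φ (ψ.symm (Pi.single i 1)))
    refine ⟨ψ.symm c, (ψ.symm c).2, fun y => ?_⟩
    have hy : y = ∑ i, ψ y i • ψ.symm (Pi.single i 1) := by
      apply ψ.injective
      simpa using hsingle (ψ y)
    rw [hτ', map_sum]
    conv_rhs => rw [hy, map_sum]
    refine Finset.sum_congr rfl fun i _ => ?_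
    rw [map_smul, ← hc, ← map_smul, ψ.apply_symm_apply, smul_eq_mul, mul_comm]

variable [SetLike.GradedMonoid 𝒜] [SetLike.GradedMonoid ℬ]
  {σ : GradedAntihom 𝒜 ℬ} {ρ : GradedAntihom ℬ 𝒜}
  {K : Type v} [AddCommGroup K] [Module k K] {τ : B →ₗ[k] K}

variable (σ τ) in
/-- The comparison of `A₀[s]` with the dual of `B₀` given by a trace form. -/
def degreeZeroToDual (s : ℤ) :
    (degreeZero 𝒜).shift s ⟶ dualObj σ K s (degreeZero ℬ) where
  app j := LinearMap.pi fun i =>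
    (((LinearMap.mul k B).compr₂ τ).domRestrict₁₂ ⊤ (zeroDeg ℬ i.1) ∘ₗ
      (σ.toLinearMap.codRestrict ⊤ fun _ => trivial)) ∘ₗ (zeroDeg 𝒜 (s + j)).subtype
  app_act {n j l} h a (x : zeroDeg 𝒜 (s + j)) := by
    refine funext fun i => LinearMap.ext fun (y : zeroDeg ℬ i) => ?_
    have hi := i.2
    refine Eq.trans ?_ (dualObj_act_apply σ K s (degreeZero ℬ) h a _ i rfl (by lia) y).symm
    change τ (σ.toLinearMap (if n = 0 then (a : A) * x else 0) * y) =
      τ (σ.toLinearMap x * (if n = 0 then σ.toLinearMap a * y else 0))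
    split_ifs
    · rw [σ.map_mul, mul_assoc]
    · simp

theorem degreeZeroToDual_apply (s : ℤ) {j : ℤ} (x : zeroDeg 𝒜 (s + j))
    (i : {i : ℤ // s + i + j = 0}) (y : zeroDeg ℬ i) :
    (degreeZeroToDual σ τ s).app j x i y = τ (σ.toLinearMap x * y) := rfl

theorem isIso_degreeZeroToDual (hρσ : ∀ a, ρ.toLinearMap (σ.toLinearMap a) = a)
    (hσρ : ∀ b, σ.toLinearMap (ρ.toLinearMap b) = b) (hτ : IsPerfectTrace ℬ τ) (s : ℤ) :
    IsIso (degreeZeroToDual σ τ s) := by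
  refine isIso_of_bijective _ fun j => ?_
  by_cases hj : s + j = 0
  · have hA : zeroDeg 𝒜 (s + j) = 𝒜 0 := zeroDeg_of_eq_zero hj
    constructor
    · rw [injective_iff_map_eq_zero]
      intro (x : zeroDeg 𝒜 (s + j)) hx
      apply Subtype.ext
      change (x : A) = 0
      -- Nondegeneracy gives `σ x = 0`, and `ρ` recovers `x`.
      rw [← hρσ x, hτ.eq_zero _ (σ.map_mem (hA ▸ x.2)) fun y hy => ?_, map_zero]
      have hy' : y ∈ zeroDeg ℬ 0 := hy
      exact LinearMap.congr_fun (congrFun hx ⟨0, by lia⟩) (⟨y, hy'⟩ : zeroDeg ℬ 0)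
    · intro φ
      obtain ⟨b, hb, h⟩ := hτ.exists_eq (φ ⟨0, by lia⟩)
      refine ⟨(⟨ρ.toLinearMap b, hA ▸ ρ.map_mem hb⟩ : zeroDeg 𝒜 (s + j)), ?_⟩
      refine funext fun ⟨i, hi⟩ => ?_
      obtain rfl : i = 0 := by lia
      refine LinearMap.ext fun (y : zeroDeg ℬ 0) => ?_
      rw [degreeZeroToDual_apply, hσρ]
      exact h y
  · constructor
    · rintro (x : zeroDeg 𝒜 (s + j)) (y : zeroDeg 𝒜 (s + j)) -
      apply Subtype.ext
      rw [eq_zero_of_mem_zeroDeg hj x.2, eq_zero_of_mem_zeroDeg hj y.2]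
    · intro φ
      refine ⟨0, funext fun i => LinearMap.ext fun (y : zeroDeg ℬ i) => ?_⟩
      have hi := i.2
      obtain rfl : y = 0 := Subtype.ext (eq_zero_of_mem_zeroDeg (by lia) y.2)
      exact (map_zero _).trans (map_zero (φ i)).symm

/-! ### Self-extensions of the degree-zero part and regularity -/

instance : HasExt.{max u (v + 1)} (GrModule 𝒜) := hasExt_of_hasDerivedCategory _

theorem subsingleton_ext_congr_right (X : GrModule 𝒜) {Y Z : GrModule 𝒜} (e : Y ≅ Z) (n : ℕ) :
    Subsingleton (Ext X Y n) ↔ Subsingleton (Ext X Z n) :=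
  ((extFunctorObj X n ⋙ forget _).mapIso e).toEquiv.subsingleton_congr

/-- The graded self-extensions of `A₀` vanish in the same degrees for anti-isomorphic algebras. -/
theorem subsingleton_ext_degreeZero_iff (hρσ : ∀ a, ρ.toLinearMap (σ.toLinearMap a) = a)
    (hσρ : ∀ b, σ.toLinearMap (ρ.toLinearMap b) = b) (hτ : IsPerfectTrace ℬ τ)
    {υ : A →ₗ[k] K} (hυ : IsPerfectTrace 𝒜 υ) (s : ℤ) (n : ℕ) :
    Subsingleton (Ext (degreeZero 𝒜) ((degreeZero 𝒜).shift s) n) ↔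
      Subsingleton (Ext (degreeZero ℬ) ((degreeZero ℬ).shift s) n) := by
  have := isIso_degreeZeroToDual hρσ hσρ hτ s
  have := isIso_degreeZeroToDual hσρ hρσ hυ s
  -- Both targets become duals with the same shift `s`, as the adjunction requires.
  rw [subsingleton_ext_congr_right _ (asIso (degreeZeroToDual σ τ s)),
    subsingleton_ext_congr_right _ (asIso (degreeZeroToDual ρ υ s))]
  exact Ext.subsingleton_iff_of_adjunction (dualAdjunction K s hρσ hσρ) (degreeZero 𝒜) n
    (degreeZero ℬ)

/-- For the standard t-structure the source is in degrees `≤ 0` and the target in degrees `≥ -m >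
0`. -/
theorem grExt_eq_zero_of_neg (X Y : GrModule 𝒜) {m : ℤ} (hm : m < 0) (i : ℤ)
    (e : GrExt ((DerivedCategory.singleFunctor (GrModule 𝒜) 0).obj X) Y m i) : e = 0 := by
  have := DerivedCategory.TStructure.t.isGE_shift
    ((DerivedCategory.singleFunctor (GrModule 𝒜) 0).obj (Y.shift i)) 0 m (-m)
  exact DerivedCategory.TStructure.t.zero e 0 (-m)

theorem isExtRegular_single_iff (X : GrModule 𝒜) (r : ℤ) :
    IsExtRegular ((DerivedCategory.singleFunctor (GrModule 𝒜) 0).obj X) r ↔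
      ∀ (n : ℕ) (i : ℤ), i ≤ -r - 1 - n →
        Subsingleton (Ext X ((degreeZero 𝒜).shift i) n) := by
  constructor
  · intro h n i hi
    rw [Ext.homEquiv.subsingleton_congr]
    exact subsingleton_of_forall_eq 0 (h n i hi)
  · intro h m i hi e
    rcases lt_or_ge m 0 with hm | hm
    · exact grExt_eq_zero_of_neg X _ hm i e
    · lift m to ℕ using hm
      have := h m i hi
      rw [Ext.homEquiv.subsingleton_congr] at this
      exact this.elim e 0

end GrModule

/-! ### The opposite algebra and the main theorem -/

/-- Passage to the opposite algebra. -/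
def GradedAntihom.toOp {k : Type u} {A : Type v} [Field k] [Ring A] [Algebra k A]
    (𝒜 : ℕ → Submodule k A) : GradedAntihom 𝒜 (opGrading 𝒜) where
  toLinearMap := (MulOpposite.opLinearEquiv k).toLinearMap
  map_one := rfl
  map_mul _ _ := rfl
  map_mem h := h

/-- Passage back from the opposite algebra. -/
def GradedAntihom.ofOp {k : Type u} {A : Type v} [Field k] [Ring A] [Algebra k A]
    (𝒜 : ℕ → Submodule k A) : GradedAntihom (opGrading 𝒜) 𝒜 where
  toLinearMap := (MulOpposite.opLinearEquiv k).symm.toLinearMap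
  map_one := rfl
  map_mul _ _ := rfl
  map_mem h := h

theorem theorem3 {k : Type u} {A : Type v} [Field k] [Ring A] [Algebra k A]
    (𝒜 : ℕ → Submodule k A) [GradedAlgebra 𝒜] (h𝒜 : IsLocallyFinitePositivelyGraded 𝒜) :
    extRegDegreeZero 𝒜 = extRegDegreeZero (opGrading 𝒜) := by
  obtain ⟨d, ⟨ψ⟩⟩ := h𝒜.zero
  -- Duals take values in the line `k · 1 ⊆ A` instead of `k`, so that they stay in the universe of
  -- `A`. It is a copy of `k` unless `A` is zero.
  let q : k →ₗ[k] LinearMap.range (Algebra.linearMap k A) := (Algebra.linearMap k A).rangeRestrict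
  have hq : Function.Surjective q := LinearMap.surjective_rangeRestrict _
  have hq' : ∀ c, q c = 0 → c • (1 : A) = 0 := fun c hc => by
    rw [← Algebra.algebraMap_eq_smul_one]
    exact congrArg Subtype.val hc
  obtain ⟨υ, hυ⟩ := GrModule.exists_isPerfectTrace ψ.toLinearEquiv (fun x y => map_mul ψ x y) hq hq'
  let e : opGrading 𝒜 0 ≃ₗ[k] 𝒜 0 :=
    LinearEquiv.ofSubmodule' (MulOpposite.opLinearEquiv k).symm (𝒜 0)
  -- The same coordinates serve the opposite algebra, because `k × ⋯ × k` is commutative.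
  obtain ⟨τ, hτ⟩ := GrModule.exists_isPerfectTrace (ℬ := opGrading 𝒜) (e.trans ψ.toLinearEquiv)
    (fun x y => (map_mul ψ (e y) (e x)).trans (mul_comm _ _)) hq
    (fun c hc => MulOpposite.unop_injective (hq' c hc))
  have key : ∀ r,
      IsExtRegular ((DerivedCategory.singleFunctor _ 0).obj (GrModule.degreeZero 𝒜)) r ↔
      IsExtRegular ((DerivedCategory.singleFunctor _ 0).obj
        (GrModule.degreeZero (opGrading 𝒜))) r := fun r => by
    simp only [GrModule.isExtRegular_single_iff,
      GrModule.subsingleton_ext_degreeZero_iff (σ := GradedAntihom.toOp 𝒜)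
        (ρ := GradedAntihom.ofOp 𝒜) (fun _ => rfl) (fun _ => rfl) hτ hυ]
  -- Both regularities are infima over the same set of integers, which covers the values `±∞` as
  -- well.
  simp only [extRegDegreeZero, extReg, key]
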